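/- Let $k$ be a field of characteristic zero, let $S=k[x_1,x_2,x_3,x_4]$, and let $f,g\in S$ be homogeneous polynomials of degree $2$ forming an $S$-regular sequence. Put $R=S/(f,g)$ and assume that $R$ is normal, i.e. every localization of $R$ at a prime ideal is an integrally closed domain. Let $\Omega=\Omega_{R/k}$ be the module of Kähler differentials. For a prime $\mathfrak p$ of $R$ write $\mu(\Omega_{\mathfrak p})$ for the minimal number of generators of the $R_{\mathfrak p}$-module $\Omega_{\mathfrak p}$, and let $\overline{\Theta}$ be the $4\times 2$ matrix over $R$ whose $i$-th row consists of the images in $R$ of $\partial f/\partial x_i$ and $\partial g/\partial x_i$ (the transposed Jacobian matrix of $f,g$ modulo $(f,g)$). Then $\Omega$ satisfies, with $d=2$ and $e=2$, the assumptions of the following setting: $R=k[x_1,\dots,x_{d+2}]/(f,g)$ with $f,g$ a regular sequence of homogeneous quadrics, $d\ge 2$, and $E$ a finitely generated torsion-free $R$-module of rank $e\ge 1$ and projective dimension one, minimally generated by $d+e$ elements, satisfying $G_d$, with a minimal free resolution $0\to R^d\xrightarrow{\varphi}R^{d+e}\to E\to 0$ whose matrix $\varphi$ has linear entries generating the ideal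 $(x_1,\dots,x_{d+2})R$. Namely: 1. $\Omega$ is a finitely generated torsion-free $R$-module of rank $2$, i.e. $\Omega\otimes_R Q\cong Q^2$ for the total ring of fractions $Q$ of $R$; 2. $\Omega$ has projective dimension exactly one; 3. the minimal number of generators of $\Omega$ is $\mu(\Omega)=4$; 4. the sequence $0\to R^2\xrightarrow{\ \overline{\Theta}\ }R^4\xrightarrow{\ \pi\ }\Omega\to 0$, where $\pi$ sends the $i$-th basis vector to $dx_i$, is exact; the entries of $\overline{\Theta}$ are images of linear forms of $S$ and lie in $(x_1,\dots,x_4)R$, so this is a minimal free resolution with linear presentation matrix; 5. $\Omega$ satisfies $G_2$, i.e. $\mu(\Omega_{\mathfrak p})\le \dim R_{\mathfrak p}+2-1$ for every prime $\mathfrak p$ of $R$ with $\dim R_{\mathfrak p}=1$; 6. the ideal $I_1(\overline{\Theta})$ generated by the entries of $\overline{\Theta}$ equals $(x_1,x_2,x_3,x_4)R$. -/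

import Mathlib

open MvPolynomial TensorProduct KaehlerDifferential

/-- A commutative ring is normal if all its localizations at prime ideals are
integrally closed domains. -/
def IsNormalRing (R : Type*) [CommRing R] : Prop :=
  ∀ (p : Ideal R) [p.IsPrime],
    IsDomain (Localization.AtPrime p) ∧ IsIntegrallyClosed (Localization.AtPrime p)

/-- `E` has rank `e`: tensored with the total ring of fractions of `R`
(the localization of `R` at all its nonzerodivisors) it becomes free of rank `e`. -/
def HasRank (R : Type*) [CommRing R] (E : Type*) [AddCommGroup E] [Module R E] (e : ℕ) : Prop :=
  Nonempty ((FractionRing R ⊗[R] E) ≃ₗ[FractionRing R] (Fin e → FractionRing R))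

/-- The minimal number of generators `μ(E)` of a finitely generated module. -/
noncomputable def minGens (R : Type*) [CommRing R] (E : Type*) [AddCommGroup E] [Module R E] : ℕ :=
  (⊤ : Submodule R E).spanFinrank

/-- The condition `G_s` for a finitely generated module `E` of rank `e`:
`μ(E_p) ≤ dim R_p + e - 1` for every prime `p` with `1 ≤ dim R_p ≤ s - 1`
(written without subtraction). -/
def SatisfiesG (R : Type*) [CommRing R] (E : Type*) [AddCommGroup E] [Module R E]
    (e s : ℕ) : Prop :=
  ∀ (p : Ideal R) [p.IsPrime],
    1 ≤ ringKrullDim (Localization.AtPrime p) →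
    ringKrullDim (Localization.AtPrime p) + 1 ≤ (s : WithBot ℕ∞) →
    (minGens (Localization.AtPrime p) (LocalizedModule p.primeCompl E) : WithBot ℕ∞) + 1 ≤
      ringKrullDim (Localization.AtPrime p) + (e : WithBot ℕ∞)

/-- The ideal `I₁(φ)` generated by the entries of a matrix. -/
def entriesIdeal {R : Type*} [CommRing R] {m n : Type*} (φ : Matrix m n R) : Ideal R :=
  Ideal.span {a | ∃ i j, φ i j = a}

/-- The ring `k[x₁,…,xₙ]/(f,g)`. -/
abbrev CIRing {k : Type*} [Field k] {n : ℕ} (f g : MvPolynomial (Fin n) k) : Type _ :=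
  MvPolynomial (Fin n) k ⧸ Ideal.span {f, g}

/-- The ideal `(x₁,…,xₙ)R` of `R = k[x₁,…,xₙ]/(f,g)`. -/
noncomputable def irrelevantIdeal {k : Type*} [Field k] {n : ℕ} (f g : MvPolynomial (Fin n) k) :
    Ideal (CIRing f g) :=
  Ideal.span (Set.range fun i => Ideal.Quotient.mk (Ideal.span {f, g}) (X i))

/-- A matrix over `k[x₁,…,xₙ]/(f,g)` with linear entries, i.e. whose entries are images of
homogeneous polynomials of degree one. -/
def HasLinearEntries {k : Type*} [Field k] {n : ℕ} {f g : MvPolynomial (Fin n) k}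
    {r c : Type*} (φ : Matrix r c (CIRing f g)) : Prop :=
  ∃ ψ : Matrix r c (MvPolynomial (Fin n) k), (∀ i j, (ψ i j).IsHomogeneous 1) ∧
    φ = ψ.map (Ideal.Quotient.mk (Ideal.span {f, g}))

/-- The standing assumptions on a linearly presented module `E` of rank `e` over a complete
intersection `R = k[x₁,…,x_{d+2}]/(f,g)` of two quadrics, with minimal free resolution
`0 → R^d → R^(d+e) → E → 0` given by the matrix `φ` and the augmentation `π`. -/
structure LinearlyPresentedOverQuadricCI {k : Type*} [Field k] {d : ℕ} (e : ℕ)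
    (f g : MvPolynomial (Fin (d + 2)) k)
    (E : Type*) [AddCommGroup E] [Module (CIRing f g) E]
    (φ : Matrix (Fin (d + e)) (Fin d) (CIRing f g))
    (π : (Fin (d + e) → CIRing f g) →ₗ[CIRing f g] E) : Prop where
  two_le_d : 2 ≤ d
  one_le_e : 1 ≤ e
  homogeneous_f : f.IsHomogeneous 2
  homogeneous_g : g.IsHomogeneous 2
  regular : RingTheory.Sequence.IsRegular (MvPolynomial (Fin (d + 2)) k) [f, g]
  finite : Module.Finite (CIRing f g) E
  torsionFree : Module.IsTorsionFree (CIRing f g) E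
  rank : HasRank (CIRing f g) E e
  projDim : CategoryTheory.projectiveDimension (ModuleCat.of (CIRing f g) E) = 1
  minGens_eq : minGens (CIRing f g) E = d + e
  injective : Function.Injective φ.mulVecLin
  exact : Function.Exact φ.mulVecLin π
  surjective : Function.Surjective π
  minimal : ∀ i j, φ i j ∈ irrelevantIdeal f g
  linear : HasLinearEntries φ
  satisfiesG : SatisfiesG (CIRing f g) E e d
  entriesIdeal_eq : entriesIdeal φ = irrelevantIdeal f g

/-- The transpose of the Jacobian matrix of `f, g`, with entries reduced modulo `(f,g)`. -/
noncomputable def jacobianTranspose {k : Type*} [Field k] {n : ℕ}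
    (f g : MvPolynomial (Fin n) k) : Matrix (Fin n) (Fin 2) (CIRing f g) :=
  Matrix.of fun i j => Ideal.Quotient.mk (Ideal.span {f, g}) (pderiv i (![f, g] j))

/-- The map `Rⁿ → Ω_{R/k}` sending the `i`-th basis vector to `dxᵢ`. -/
noncomputable def differentialsMap {k : Type*} [Field k] {n : ℕ}
    (f g : MvPolynomial (Fin n) k) :
    (Fin n → CIRing f g) →ₗ[CIRing f g] Ω[CIRing f g⁄k] :=
  Fintype.linearCombination (CIRing f g)
    fun i => KaehlerDifferential.D k (CIRing f g) (Ideal.Quotient.mk (Ideal.span {f, g}) (X i))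

-- The engine is one half of the Jacobian criterion, in terms of derivations. At a prime `P` with `K
-- = Frac(R/P)`, the kernel of the transposed matrix over `K` is the space of `k`-derivations `R →
-- K`. If these are determined by their values on 2 elements of `R`, the kernel has dimension at
-- most 2, so the Jacobian matrix has full rank 2 at `P`; this is recorded denominator-free as `C *
-- Θ = δ • 1` with `δ ∉ P`.
--
-- In characteristic zero a derivation that kills `P` is determined on lifts of a transcendence
-- basis of `R/P`. Here `R` is a domain (it is graded and its localization at the origin is a
-- domain) of transcendence degree at most 2. So 2 elements suffice at `P = 0`; if `P ≠ 0` is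
-- locally principal, one lifted element and one local generator suffice.
--
-- Full rank at `0` gives injectivity of the matrix and the rank of `Ω`. Full rank at height-one
-- primes, locally principal by normality, gives `G_2`. Torsion-freeness follows because in a normal
-- Noetherian domain divisibility by `r` is tested at locally principal primes. Exactness is the
-- universal property of `Ω`, and since the entries of the matrix lie in a proper ideal, the
-- generators are minimal and the resolution does not split.
--
-- If the entries failed to generate the irrelevant ideal, the linear forms would have a common zero
-- `a ≠ 0`. By Euler's formula the line through `a` lies in `V(f, g)`, and the matrix vanishes along
-- it. Its prime is nonzero and locally principal, contradicting full rank.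

universe u

/-! ### Transcendence degree of proper quotients -/

section TranscendenceDegree

/-- A non-injective surjection out of a domain strictly lowers the transcendence degree. -/
theorem trdeg_add_one_le_of_surjective_of_not_injective {k A B : Type u} [Field k] [CommRing A]
    [IsDomain A] [CommRing B] [IsDomain B] [Algebra k A] [Algebra k B] (φ : A →ₐ[k] B)
    (hφ : Function.Surjective φ) (hφ' : ¬ Function.Injective φ) :
    Algebra.trdeg k B + 1 ≤ Algebra.trdeg k A := by
  obtain ⟨a, ha, ha0⟩ : ∃ a, φ a = 0 ∧ a ≠ 0 := by
    rw [injective_iff_map_eq_zero] at hφ'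
    push Not at hφ'
    exact hφ'
  obtain ⟨ι, y, hy⟩ := exists_isTranscendenceBasis' k B
  choose x hx using fun i => hφ (y i)
  have hxy : φ ∘ x = y := funext hx
  have hxi : AlgebraicIndependent k x := AlgebraicIndependent.of_comp φ (hxy ▸ hy.1)
  have hinj : ∀ c ∈ Algebra.adjoin k (Set.range x), φ c = 0 → c = 0 := by
    intro c hc hc0
    rw [Algebra.adjoin_range_eq_range_aeval] at hc
    obtain ⟨p, rfl⟩ := hc
    have h1 : aeval y p = 0 := by
      rw [← hc0, ← hxy]
      exact (comp_aeval_apply x φ p).symm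
    simp [(injective_iff_map_eq_zero _).mp hy.1 p h1]
  -- A nonzero `a` in the kernel is transcendental over the lifted basis: an algebraic relation can
  -- be taken with nonzero constant term, but `φ` kills that term and is injective on the
  -- subalgebra.
  have htr : Transcendental (Algebra.adjoin k (Set.range x)) a := by
    intro halg
    obtain ⟨q, hq0, hq⟩ := halg.exists_nonzero_coeff_and_aeval_eq_zero
      (mem_nonZeroDivisors_of_ne_zero ha0)
    obtain ⟨p, hp⟩ := Polynomial.X_dvd_sub_C (p := q)
    apply hq0
    apply Subtype.ext
    apply hinj _ (q.coeff 0).2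
    have h2 := congrArg (fun r => φ (Polynomial.aeval a r)) hp
    simp only [map_sub, map_mul, hq, Polynomial.aeval_C, Polynomial.aeval_X, ha, zero_mul,
      zero_sub, map_neg] at h2
    exact neg_eq_zero.mp h2
  have := ((hxi.option_iff_transcendental a).mpr htr).cardinalMk_le_trdeg
  rwa [Cardinal.mk_option, hy.cardinalMk_eq_trdeg] at this

theorem trdeg_le_of_surjective_of_not_injective {k A B : Type u} [Field k] [CommRing A]
    [IsDomain A] [CommRing B] [IsDomain B] [Algebra k A] [Algebra k B] (φ : A →ₐ[k] B)
    (hφ : Function.Surjective φ) (hφ' : ¬ Function.Injective φ) {n : ℕ}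
    (hn : Algebra.trdeg k A ≤ (n + 1 : ℕ)) : Algebra.trdeg k B ≤ n := by
  have := (trdeg_add_one_le_of_surjective_of_not_injective φ hφ hφ').trans hn
  rw [Nat.cast_add, Nat.cast_one] at this
  exact Cardinal.add_one_le_add_one_iff.mp this

end TranscendenceDegree

/-! ### Derivations in characteristic zero -/

theorem Derivation.eq_zero_of_isTranscendenceBasis {k B M ι : Type*} [Field k] [CharZero k]
    [CommRing B] [IsDomain B] [Algebra k B] [AddCommGroup M] [Module k M] [Module B M]
    [IsScalarTower k B M] [Module.IsTorsionFree B M] {s : ι → B} (hs : IsTranscendenceBasis k s)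
    (D : Derivation k B M) (h : ∀ i, D (s i) = 0) : D = 0 := by
  have hA : ∀ a ∈ Algebra.adjoin k (Set.range s), D a = 0 := by
    intro a ha
    have := Derivation.eqOn_adjoin (D1 := D) (D2 := 0) (s := Set.range s)
      (by rintro _ ⟨i, rfl⟩; simpa using h i) ha
    simpa using this
  let D' : Derivation (Algebra.adjoin k (Set.range s)) B M :=
    { toFun := D
      map_add' := D.map_add
      map_smul' := fun a b => by
        change D (a.1 * b) = a.1 • D b
        rw [D.leibniz, hA a.1 a.2, smul_zero, add_zero]
      map_one_eq_zero' := D.map_one_eq_zero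
      leibniz' := D.leibniz }
  ext y
  by_contra hy
  have : CharZero (Algebra.adjoin k (Set.range s)) := charZero_of_injective_algebraMap
    (FaithfulSMul.algebraMap_injective k _)
  have : IsAddTorsionFree (Algebra.adjoin k (Set.range s)) := inferInstance
  have := hs.isAlgebraic
  -- Applying `D'` to `q(y) = 0` gives `q'(y) • D y = 0`. As `D y ≠ 0`, also `q'(y) = 0`, so `q' =
  -- 0` by induction on the degree, and `q` is constant in characteristic zero.
  have key : ∀ (n : ℕ) (q : Polynomial (Algebra.adjoin k (Set.range s))), q.natDegree ≤ n →
      Polynomial.aeval y q = 0 → q = 0 := by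
    intro n
    induction n with
    | zero =>
      intro q hq h0
      rw [Polynomial.eq_C_of_natDegree_eq_zero (Nat.le_zero.mp hq)] at h0 ⊢
      rw [Polynomial.aeval_C] at h0
      rw [(FaithfulSMul.algebraMap_eq_zero_iff _ _).mp h0, Polynomial.C_0]
    | succ n ih =>
      intro q hq h0
      have h1 := D'.map_aeval q y
      rw [h0, map_zero, eq_comm, smul_eq_zero] at h1
      have h2 := ih _ ((Polynomial.natDegree_derivative_le q).trans (by omega))
        (h1.resolve_right hy)
      exact ih q (by simp [Polynomial.derivative_eq_zero.mp h2]) h0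
  obtain ⟨q, hq, hq0⟩ := Algebra.IsAlgebraic.isAlgebraic
    (R := Algebra.adjoin k (Set.range s)) y
  exact hq (key _ q le_rfl hq0)

theorem exists_fin_forall_derivation_eq_zero {k B : Type*} [Field k] [CharZero k]
    [CommRing B] [IsDomain B] [Algebra k B] {n : ℕ} (hn : Algebra.trdeg k B ≤ n) :
    ∃ b : Fin n → B, ∀ (M : Type*) [AddCommGroup M] [Module k M] [Module B M]
      [IsScalarTower k B M] [Module.IsTorsionFree B M] (D : Derivation k B M),
      (∀ i, D (b i) = 0) → D = 0 := by
  obtain ⟨ι, x, hx⟩ := exists_isTranscendenceBasis' k B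
  have h1 := hx.lift_cardinalMk_eq_trdeg
  simp only [Cardinal.lift_id] at h1
  rw [← h1, ← Cardinal.lift_mk_fin, ← Cardinal.lift_uzero (Cardinal.mk ι), Cardinal.lift_mk_le'] at hn
  obtain ⟨e⟩ := hn
  -- The basis may have fewer than `n` elements; it is padded with zeros.
  refine ⟨Function.extend e x 0, fun M _ _ _ _ _ D hD =>
    D.eq_zero_of_isTranscendenceBasis hx fun i => ?_⟩
  simpa [e.injective.extend_apply] using hD (e i)

/-- A derivation into a module over `A ⧸ I` that kills `I` descends to `A ⧸ I`. -/
theorem Derivation.exists_quotient_lift {k A N : Type*} [CommRing k] [CommRing A] [Algebra k A]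
    (I : Ideal A) [AddCommGroup N] [Module k N] [Module A N] [Module (A ⧸ I) N]
    [IsScalarTower A (A ⧸ I) N] (D : Derivation k A N) (hD : ∀ a ∈ I, D a = 0) :
    ∃ D' : Derivation k (A ⧸ I) N, ∀ a, D' (Ideal.Quotient.mk I a) = D a := by
  have hs : ∀ (a : A) (n : N), Ideal.Quotient.mk I a • n = a • n := fun a n =>
    algebraMap_smul (A ⧸ I) a n
  let L : (A ⧸ I) →ₗ[k] N := ((I.restrictScalars k).liftQ D.toLinearMap (fun a ha => hD a ha))
  have hL : ∀ a, L (Ideal.Quotient.mk I a) = D a := fun a => rfl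
  refine ⟨Derivation.mk' L ?_, hL⟩
  intro a b
  obtain ⟨a, rfl⟩ := Ideal.Quotient.mk_surjective a
  obtain ⟨b, rfl⟩ := Ideal.Quotient.mk_surjective b
  rw [← map_mul, hL, hL, hL, D.leibniz, hs, hs]

theorem MvPolynomial.mkDerivation_eq_sum {k σ N : Type*} [CommRing k] [Fintype σ]
    [AddCommGroup N] [Module k N] [Module (MvPolynomial σ k) N]
    [IsScalarTower k (MvPolynomial σ k) N] (a : σ → N) (p : MvPolynomial σ k) :
    mkDerivation k a p = ∑ i, pderiv i p • a i := by
  classical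
  let D : Derivation k (MvPolynomial σ k) N :=
    ∑ i, ((LinearMap.toSpanSingleton (MvPolynomial σ k) N (a i)).compDer (pderiv i))
  have h : ∀ p, D p = ∑ i, pderiv i p • a i := fun p => by
    simp only [D, ← Derivation.coeFnAddMonoidHom_apply, map_sum, Finset.sum_apply]
    rfl
  rw [← h]
  congr 1
  refine MvPolynomial.derivation_ext fun j => ?_
  rw [h, mkDerivation_X]
  simp [pderiv_X, Pi.single_apply]

/-! ### Jacobian presentations of the differentials -/

/-- `R` is generated as a `k`-algebra by the family `x`, and the columns of `Θ` generate the
relations between the differentials of the `x i`. -/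
structure IsJacobianPresentation (k : Type u) {R : Type u} [Field k] [CommRing R] [Algebra k R]
    {m n : Type} [Fintype m] (x : m → R) (Θ : Matrix m n R) : Prop where
  adjoin_eq_top : Algebra.adjoin k (Set.range x) = ⊤
  sum_smul_D : ∀ j, ∑ i, Θ i j • KaehlerDifferential.D k R (x i) = 0
  exists_derivation : ∀ (N : Type u) [AddCommGroup N] [Module k N] [Module R N]
    [IsScalarTower k R N] (a : m → N), (∀ j, ∑ i, Θ i j • a i = 0) →
    ∃ D : Derivation k R N, ∀ i, D (x i) = a i

theorem isJacobianPresentation_jacobianTranspose {k : Type u} [Field k] {n : ℕ}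
    (f g : MvPolynomial (Fin n) k) :
    IsJacobianPresentation k (fun i => Ideal.Quotient.mk (Ideal.span {f, g}) (X i))
      (jacobianTranspose f g) where
  adjoin_eq_top := by
    have h1 : (Set.range fun i => Ideal.Quotient.mk (Ideal.span {f, g}) (X i)) =
        (Ideal.Quotient.mkₐ k (Ideal.span {f, g})) '' (Set.range X) := by
      rw [← Set.range_comp]; rfl
    rw [h1, ← AlgHom.map_adjoin, MvPolynomial.adjoin_range_X, Algebra.map_top,
      AlgHom.range_eq_top]
    exact Ideal.Quotient.mkₐ_surjective _ _
  sum_smul_D := fun j => by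
    have h0 : Ideal.Quotient.mk (Ideal.span {f, g}) (![f, g] j) = 0 := by
      rw [Ideal.Quotient.eq_zero_iff_mem]
      fin_cases j <;> exact Ideal.subset_span (by simp)
    have h1 : ∀ p : MvPolynomial (Fin n) k,
        KaehlerDifferential.D k (CIRing f g) (Ideal.Quotient.mk (Ideal.span {f, g}) p) =
        ∑ i, Ideal.Quotient.mk (Ideal.span {f, g}) (pderiv i p) •
          KaehlerDifferential.D k (CIRing f g) (Ideal.Quotient.mk (Ideal.span {f, g}) (X i)) := by
      intro p
      have h2 : (KaehlerDifferential.D k (CIRing f g)).compAlgebraMap (MvPolynomial (Fin n) k) =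
          mkDerivation k fun i => KaehlerDifferential.D k (CIRing f g)
            (Ideal.Quotient.mk (Ideal.span {f, g}) (X i)) :=
        MvPolynomial.derivation_ext fun i => by rw [mkDerivation_X]; rfl
      refine (Derivation.congr_fun h2 p).trans ?_
      rw [mkDerivation_eq_sum]
      exact Finset.sum_congr rfl fun i _ =>
        (algebraMap_smul (CIRing f g) (pderiv i p) (_ : Ω[CIRing f g⁄k])).symm
    rw [← (KaehlerDifferential.D k (CIRing f g)).map_zero, ← h0, h1]
    rfl
  exists_derivation := fun N _ _ _ _ a h => by
    let : Module (MvPolynomial (Fin n) k) N :=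
      Module.compHom N (Ideal.Quotient.mk (Ideal.span {f, g}))
    have hsm : ∀ (p : MvPolynomial (Fin n) k) (m : N),
      p • m = Ideal.Quotient.mk (Ideal.span {f, g}) p • m := fun _ _ => rfl
    have : IsScalarTower (MvPolynomial (Fin n) k) (CIRing f g) N :=
      ⟨fun p r m => mul_smul (Ideal.Quotient.mk (Ideal.span {f, g}) p) r m⟩
    have : IsScalarTower k (MvPolynomial (Fin n) k) N :=
      ⟨fun c p m => by
        rw [hsm, hsm, ← smul_assoc]
        rfl⟩
    have hfg : ∀ j, mkDerivation k a (![f, g] j) = 0 := fun j => by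
      rw [mkDerivation_eq_sum, ← h j]
      rfl
    obtain ⟨D, hD⟩ := Derivation.exists_quotient_lift (Ideal.span {f, g}) (mkDerivation k a) (by
      intro p hp
      obtain ⟨u, v, rfl⟩ := Ideal.mem_span_pair.mp hp
      have hf := hfg 0
      have hg := hfg 1
      simp only [Matrix.cons_val_zero, Matrix.cons_val_one] at hf hg
      have h1 : ∀ (q w : MvPolynomial (Fin n) k), q ∈ Ideal.span {f, g} →
          q • (mkDerivation k a w : N) = 0 := by
        intro q w hq
        rw [hsm, Ideal.Quotient.eq_zero_iff_mem.mpr hq]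
        exact zero_smul (CIRing f g) (mkDerivation k a w : N)
      rw [map_add, Derivation.leibniz, Derivation.leibniz, hf, hg, smul_zero, smul_zero,
        h1 f u (Ideal.subset_span (by simp)), h1 g v (Ideal.subset_span (by simp))]
      simp)
    exact ⟨D, fun i => by rw [hD, mkDerivation_X]⟩

/-! ### Rank of the Jacobian matrix at a prime -/

/-- Derivations on `R` with values in the residue field at `P` that vanish on `P` are determined by
their values on lifts of a transcendence basis of `R ⧸ P`. -/
theorem exists_fin_forall_derivation_eq_zero_of_prime {k R : Type*} [Field k] [CharZero k]
    [CommRing R] [Algebra k R] (P : Ideal R) [P.IsPrime] {n : ℕ}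
    (hn : Algebra.trdeg k (R ⧸ P) ≤ n) :
    ∃ b : Fin n → R, ∀ D : Derivation k R (FractionRing (R ⧸ P)),
      (∀ p ∈ P, D p = 0) → (∀ i, D (b i) = 0) → D = 0 := by
  obtain ⟨b, hb⟩ := exists_fin_forall_derivation_eq_zero hn
  choose c hc using fun i => Ideal.Quotient.mk_surjective (b i)
  refine ⟨c, fun D hD hDc => ?_⟩
  obtain ⟨D', hD'⟩ := D.exists_quotient_lift P hD
  have h0 := hb _ D' fun i => by rw [← hc, hD', hDc]
  ext r
  rw [← hD', h0]
  rfl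

/-- A matrix over `R` whose transpose, over the residue field at `P`, is surjective,
has a left inverse up to a scalar outside `P`. -/
theorem Matrix.exists_mul_eq_smul_one_of_surjective {R : Type*} [CommRing R] (P : Ideal R)
    [P.IsPrime] {m n : Type*} [Fintype m] [Fintype n] [DecidableEq n] (Θ : Matrix m n R)
    (h : Function.Surjective
      (Θ.map (algebraMap R (FractionRing (R ⧸ P)))).transpose.mulVecLin) :
    ∃ (C : Matrix n m R) (c : R), c ∉ P ∧ C * Θ = c • (1 : Matrix n n R) := by
  classical
  set K := FractionRing (R ⧸ P)
  choose v hv using fun j => h (Pi.single j 1)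
  obtain ⟨s, hs⟩ := IsLocalization.exist_integer_multiples_of_finite (nonZeroDivisors (R ⧸ P))
    (fun q : n × m => v q.1 q.2)
  choose w hw using hs
  obtain ⟨t, ht⟩ := Ideal.Quotient.mk_surjective (s : R ⧸ P)
  choose C hC using fun q => Ideal.Quotient.mk_surjective (w q)
  have htP : t ∉ P := by
    intro h0
    rw [Ideal.Quotient.eq_zero_iff_mem.mpr h0] at ht
    exact nonZeroDivisors.ne_zero s.2 ht.symm
  let C' : Matrix n m R := fun j i => C (j, i)
  have key : ∀ j j', Ideal.Quotient.mk P ((C' * Θ) j j') =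
      Ideal.Quotient.mk P ((t • (1 : Matrix n n R)) j j') := by
    intro j j'
    apply IsFractionRing.injective (R ⧸ P) K
    have h1 := congrFun (hv j) j'
    simp only [Matrix.mulVecLin_apply, Matrix.mulVec, dotProduct, Matrix.transpose_apply,
      Matrix.map_apply] at h1
    have h2 : ∀ r : R, algebraMap (R ⧸ P) K (Ideal.Quotient.mk P r) = algebraMap R K r :=
      fun r => rfl
    rw [Matrix.mul_apply, map_sum, map_sum]
    have h3 : ∀ i, algebraMap (R ⧸ P) K (Ideal.Quotient.mk P (C' j i * Θ i j')) =
        algebraMap R K t * (algebraMap R K (Θ i j') * v j i) := by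
      intro i
      have := hw (j, i)
      rw [← hC, h2, Algebra.smul_def, ← ht, h2] at this
      rw [map_mul, map_mul, h2, h2]
      change algebraMap R K (C (j, i)) * _ = _
      rw [this]
      ring
    simp_rw [h3]
    rw [← Finset.mul_sum, h1, h2, Matrix.smul_apply, smul_eq_mul, map_mul, Matrix.one_apply,
      Pi.single_apply]
    congr 1
    by_cases hjj : j = j' <;> simp [hjj, eq_comm]
  -- `C' * Θ` is `t • 1` only modulo `P`. Its determinant is a power of `t` modulo `P`, and the
  -- adjugate turns the congruence into an equality.
  refine ⟨(C' * Θ).adjugate * C', (C' * Θ).det, ?_, ?_⟩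
  · rw [← Ideal.Quotient.eq_zero_iff_mem, RingHom.map_det]
    have : (Ideal.Quotient.mk P).mapMatrix (C' * Θ) =
        (Ideal.Quotient.mk P).mapMatrix (t • (1 : Matrix n n R)) := by
      ext j j'
      exact key j j'
    rw [this, ← RingHom.map_det, Matrix.det_smul, Matrix.det_one, mul_one,
      Ideal.Quotient.eq_zero_iff_mem]
    exact fun h0 => htP (Ideal.IsPrime.mem_of_pow_mem ‹_› _ h0)
  · rw [Matrix.mul_assoc, Matrix.adjugate_mul]

namespace IsJacobianPresentation

variable {k R : Type u} [Field k] [CommRing R] [Algebra k R]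

section

variable {m n : Type} [Fintype m] {x : m → R} {Θ : Matrix m n R}

theorem derivation_ext (H : IsJacobianPresentation k x Θ) {N : Type*} [AddCommGroup N] [Module k N]
    [Module R N] {D₁ D₂ : Derivation k R N} (h : ∀ i, D₁ (x i) = D₂ (x i)) : D₁ = D₂ :=
  Derivation.ext_of_adjoin_eq_top _ H.adjoin_eq_top (by rintro _ ⟨i, rfl⟩; exact h i)

end

/-- If derivations of `R` into the residue field at `P` are determined by their values on
`d` elements, then the Jacobian matrix has full rank at `P`. -/
theorem exists_mul_eq_smul_one {d c : ℕ} {x : Fin (d + c) → R} {Θ : Matrix (Fin (d + c)) (Fin c) R}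
    (H : IsJacobianPresentation k x Θ) (P : Ideal R) [P.IsPrime] (t : Fin d → R)
    (ht : ∀ D : Derivation k R (FractionRing (R ⧸ P)), (∀ i, D (t i) = 0) → D = 0) :
    ∃ (C : Matrix (Fin c) (Fin (d + c)) R) (δ : R), δ ∉ P ∧
      C * Θ = δ • (1 : Matrix (Fin c) (Fin c) R) := by
  apply Matrix.exists_mul_eq_smul_one_of_surjective
  set K := FractionRing (R ⧸ P)
  set T := (Θ.map (algebraMap R K)).transpose.mulVecLin with hT
  have hder : ∀ a : LinearMap.ker T, ∃ D : Derivation k R K, ∀ i, D (x i) = a.1 i := by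
    intro a
    apply H.exists_derivation
    intro j
    have := congrFun (LinearMap.mem_ker.mp a.2) j
    simp only [Algebra.smul_def]
    exact this
  choose D hD using hder
  -- Elements of `ker T` are derivations, so evaluation at `t` embeds `ker T` in `K ^ d`;
  -- rank-nullity then leaves rank at least `c`.
  let ev : LinearMap.ker T →ₗ[K] (Fin d → K) :=
    { toFun := fun a i => D a (t i)
      map_add' := fun a b => by
        have : D (a + b) = D a + D b := H.derivation_ext fun i => by simp [hD]
        ext i
        simp [this]
      map_smul' := fun c a => by
        have : D (c • a) = c • D a := H.derivation_ext fun i => by simp [hD]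
        ext i
        simp [this] }
  have hev : Function.Injective ev := by
    rw [injective_iff_map_eq_zero]
    intro a ha
    have h0 : D a = 0 := ht _ fun i => congrFun ha i
    ext i
    rw [← hD, h0]
    rfl
  have h1 := LinearMap.finrank_le_finrank_of_injective hev
  have h2 := T.finrank_range_add_finrank_ker
  rw [Module.finrank_fin_fun] at h1 h2
  rw [← LinearMap.range_eq_top]
  apply Submodule.eq_top_of_finrank_eq
  have h3 := (LinearMap.range T).finrank_le
  rw [Module.finrank_fin_fun] at h3 ⊢
  have h4 := h2.symm.le.trans (Nat.add_le_add_left h1 _)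
  exact le_antisymm h3 (Nat.le_of_add_le_add_left (h4.trans (Nat.add_comm _ _).le))

end IsJacobianPresentation

/-! ### Numbers of generators and fibre dimensions -/

theorem minGens_eq_of_linearEquiv {R M N : Type*} [CommRing R] [AddCommGroup M] [Module R M]
    [AddCommGroup N] [Module R N] (e : M ≃ₗ[R] N) : minGens R M = minGens R N := by
  rw [minGens, minGens, ← Submodule.spanFinrank_map_eq_of_injective e.toLinearMap e.injective,
    Submodule.map_top, LinearEquiv.range]

theorem finrank_residueField_tensor_eq_minGens (A M : Type*) [CommRing A] [IsLocalRing A]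
    [AddCommGroup M] [Module A M] [Module.Finite A M] :
    Module.finrank (IsLocalRing.ResidueField A) (IsLocalRing.ResidueField A ⊗[A] M) =
      minGens A M := by
  have h := TensorProduct.spanFinrank_top_eq_of_residueField (⊤ : Submodule A M) Module.Finite.fg_top
  rw [← Module.finrank_eq_spanFinrank_of_free] at h
  rw [minGens, ← h]
  exact ((Submodule.topEquiv (R := A) (M := M)).symm.baseChange A
    (IsLocalRing.ResidueField A) _ _).finrank_eq

theorem minGens_localizedModule_eq_finrank {R M : Type*} [CommRing R] [AddCommGroup M] [Module R M]
    [Module.Finite R M] (p : Ideal R) [p.IsPrime] :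
    minGens (Localization.AtPrime p) (LocalizedModule p.primeCompl M) =
      Module.finrank p.ResidueField (p.ResidueField ⊗[R] M) := by
  rw [minGens_eq_of_linearEquiv (LocalizedModule.equivTensorProduct p.primeCompl M),
    ← finrank_residueField_tensor_eq_minGens]
  exact (AlgebraTensorModule.cancelBaseChange R (Localization.AtPrime p) p.ResidueField
    p.ResidueField M).finrank_eq

/-- The cokernel of a matrix with `c` columns and full rank over `L` has rank `d` over `L`. -/
theorem finrank_tensor_eq_of_exact {R M L : Type*} [CommRing R] [AddCommGroup M] [Module R M]
    [Field L] [Algebra R L] {d c : ℕ} {Θ : Matrix (Fin (d + c)) (Fin c) R}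
    {π : (Fin (d + c) → R) →ₗ[R] M} (hπ : Function.Surjective π)
    (hex : Function.Exact Θ.mulVecLin π) {C : Matrix (Fin c) (Fin (d + c)) R} {δ : R}
    (hC : C * Θ = δ • (1 : Matrix (Fin c) (Fin c) R)) (hδ : algebraMap R L δ ≠ 0) :
    Module.finrank L (L ⊗[R] M) = d := by
  have h1 : Function.Exact (Θ.mulVecLin.baseChange L) (π.baseChange L) := lTensor_exact L hex hπ
  have h2 : Function.Surjective (π.baseChange L) := LinearMap.lTensor_surjective L hπ
  have h3 : Function.Injective (Θ.mulVecLin.baseChange L) := by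
    have h4 : (C.mulVecLin.baseChange L) ∘ₗ (Θ.mulVecLin.baseChange L) =
        algebraMap R L δ • LinearMap.id := by
      rw [← LinearMap.baseChange_comp, ← Matrix.mulVecLin_mul, hC]
      have : (δ • (1 : Matrix (Fin c) (Fin c) R)).mulVecLin = δ • LinearMap.id := by
        ext; simp
      rw [this, LinearMap.baseChange_smul, LinearMap.baseChange_id, algebraMap_smul]
    rw [injective_iff_map_eq_zero]
    intro z hz
    have h5 := LinearMap.congr_fun h4 z
    simp only [LinearMap.comp_apply, hz, map_zero, LinearMap.smul_apply, LinearMap.id_apply] at h5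
    exact (smul_eq_zero.mp h5.symm).resolve_left hδ
  have : Nontrivial R := (algebraMap R L).domain_nontrivial
  have h4 := (π.baseChange L).finrank_range_add_finrank_ker
  rw [LinearMap.range_eq_top.mpr h2, finrank_top, (LinearMap.exact_iff.mp h1),
    LinearMap.finrank_range_of_inj h3, Module.finrank_baseChange (M' := Fin (d + c) → R),
    Module.finrank_baseChange (M' := Fin c → R),
    Module.finrank_fin_fun, Module.finrank_fin_fun] at h4
  exact Nat.add_right_cancel h4

/-! ### Torsion-freeness over a normal domain -/

/-- In an integrally closed Noetherian domain, the annihilator of a nonzero element modulo a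
principal ideal is contained in a prime that is locally principal. -/
theorem exists_prime_locally_principal {R : Type*} [CommRing R] [IsDomain R] [IsNoetherianRing R]
    [IsIntegrallyClosed R] {r u : R} (hr : r ≠ 0) (hu : ¬ r ∣ u) :
    ∃ P : Ideal R, P.IsPrime ∧ r ∈ P ∧ (∀ a, r ∣ a * u → a ∈ P) ∧
      ∃ π ∈ P, ∀ p ∈ P, ∃ s ∉ P, ∃ a, s * p = a * π := by
  have hmk : (Ideal.Quotient.mk (Ideal.span {r}) u) ≠ 0 := by
    rwa [Ne, Ideal.Quotient.eq_zero_iff_mem, Ideal.mem_span_singleton]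
  obtain ⟨P, hP, hle⟩ := exists_le_isAssociatedPrime_of_isNoetherianRing R _ hmk
  rw [isAssociatedPrime_iff] at hP
  obtain ⟨hprime, y, hy⟩ := hP
  obtain ⟨v, rfl⟩ := Ideal.Quotient.mk_surjective y
  have hmem : ∀ (a w : R), a ∈ (⊥ : Submodule R (R ⧸ Ideal.span {r})).colon
      {Ideal.Quotient.mk (Ideal.span {r}) w} ↔ r ∣ a * w := by
    intro a w
    rw [Submodule.mem_colon_singleton, Submodule.mem_bot, ← Ideal.mem_span_singleton,
      ← Ideal.Quotient.eq_zero_iff_mem, map_mul]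
    rfl
  have hPv : ∀ a, a ∈ P ↔ r ∣ a * v := fun a => by rw [hy, hmem]
  refine ⟨P, hprime, (hPv r).mpr ⟨v, rfl⟩, fun a ha => hle ((hmem a u).mpr ha), ?_⟩
  have hrv : ¬ r ∣ v := fun h => hprime.ne_top
    ((Ideal.eq_top_iff_one P).mpr ((hPv 1).mpr (by rwa [one_mul])))
  -- Otherwise multiplication by `v / r` maps the finitely generated nonzero ideal `P` into itself,
  -- so `v / r` is integral, hence in `R`, contradicting `¬ r ∣ v`.
  obtain ⟨π, hπ, s, hs, hsπ⟩ : ∃ π ∈ P, ∃ s ∉ P, π * v = r * s := by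
    by_contra! hcon
    let K := FractionRing R
    have hrK : algebraMap R K r ≠ 0 := IsFractionRing.to_map_eq_zero_iff.not.mpr hr
    have hint : IsIntegral R (algebraMap R K v / algebraMap R K r) := by
      refine isIntegral_of_smul_mem_submodule (Submodule.map (Algebra.linearMap R K) P) ?_ ?_ _ ?_
      · rw [Submodule.ne_bot_iff]
        exact ⟨_, ⟨r, (hPv r).mpr ⟨v, rfl⟩, rfl⟩, hrK⟩
      · exact Submodule.FG.map _ (IsNoetherian.noetherian _)
      · rintro _ ⟨p, hp, rfl⟩
        obtain ⟨b, hb⟩ := (hPv p).mp hp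
        refine ⟨b, by_contra fun hbP => hcon p hp b hbP hb, ?_⟩
        have := congrArg (algebraMap R K) hb
        rw [map_mul, map_mul] at this
        rw [Algebra.linearMap_apply, Algebra.linearMap_apply, smul_eq_mul, div_mul_eq_mul_div,
          eq_div_iff hrK, mul_comm, ← this, mul_comm]
    obtain ⟨y, hy⟩ := IsIntegrallyClosed.algebraMap_eq_of_integral hint
    refine hrv ⟨y, ?_⟩
    apply IsFractionRing.injective R K
    rw [map_mul, hy, mul_div_cancel₀ _ hrK]
  refine ⟨π, hπ, fun p hp => ?_⟩
  obtain ⟨b, hb⟩ := (hPv p).mp hp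
  refine ⟨s, hs, b, mul_left_cancel₀ hr ?_⟩
  linear_combination (-p) * hsπ + π * hb

/-- The cokernel of a matrix over an integrally closed Noetherian domain which has full rank
at all nonzero locally principal primes is torsion-free. -/
theorem isTorsionFree_of_exact {R M : Type*} [CommRing R] [IsDomain R] [IsNoetherianRing R]
    [IsIntegrallyClosed R] [AddCommGroup M] [Module R M] {m n : Type*} [Fintype m] [Fintype n]
    [DecidableEq n] {Θ : Matrix m n R} {π : (m → R) →ₗ[R] M} (hπ : Function.Surjective π)
    (hex : Function.Exact Θ.mulVecLin π)
    (hC : ∀ P : Ideal R, P.IsPrime → P ≠ ⊥ →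
      (∃ π ∈ P, ∀ p ∈ P, ∃ s ∉ P, ∃ a, s * p = a * π) →
      ∃ (C : Matrix n m R) (δ : R), δ ∉ P ∧ C * Θ = δ • (1 : Matrix n n R)) :
    Module.IsTorsionFree R M where
  isSMulRegular r hr := by
    have hr0 : r ≠ 0 := hr.ne_zero
    rw [isSMulRegular_iff_right_eq_zero_of_smul]
    intro ω hω
    obtain ⟨v, rfl⟩ := hπ ω
    rw [← map_smul] at hω
    obtain ⟨w, hw⟩ := (hex _).mp hω
    have hdvd : ∀ j, r ∣ w j := by
      intro j
      by_contra hj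
      obtain ⟨P, hP, hrP, hann, hloc⟩ := exists_prime_locally_principal hr0 hj
      obtain ⟨C, δ, hδ, hCΘ⟩ := hC P hP (fun h => hr0 (by rwa [h] at hrP)) hloc
      -- Applying `C` to `Θ w = r v` gives `δ w = r (C v)`, so `r ∣ δ * w j`, which would force `δ ∈
      -- P`.
      refine hδ (hann δ ⟨(C.mulVec v) j, ?_⟩)
      have h1 := congrArg (fun z => C.mulVec z j) hw
      simp only [Matrix.mulVecLin_apply, Matrix.mulVec_mulVec, hCΘ, Matrix.smul_mulVec,
        Matrix.one_mulVec, Matrix.mulVec_smul, Pi.smul_apply, smul_eq_mul] at h1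
      exact h1
    choose w' hw' using hdvd
    have hv : v = Θ.mulVecLin w' := by
      have h2 : r • v = r • Θ.mulVecLin w' := by
        rw [← hw, ← map_smul]
        congr 1
        ext j
        exact hw' j
      exact smul_right_injective _ hr0 h2
    exact (hex v).mpr ⟨w', hv.symm⟩

/-! ### Projective dimension -/

theorem projectiveDimension_eq_one_of_exact {R M : Type u} [CommRing R] [AddCommGroup M]
    [Module R M] {m n : ℕ} [NeZero n] {Θ : Matrix (Fin m) (Fin n) R} {π : (Fin m → R) →ₗ[R] M}
    (hΘ : Function.Injective Θ.mulVecLin) (hπ : Function.Surjective π)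
    (hex : Function.Exact Θ.mulVecLin π) {I : Ideal R} (hI : I ≠ ⊤) (hΘI : ∀ i j, Θ i j ∈ I) :
    CategoryTheory.projectiveDimension (ModuleCat.of R M) = 1 := by
  apply le_antisymm
  · refine (CategoryTheory.projectiveDimension_le_iff _ 1).mpr ?_
    let S : CategoryTheory.ShortComplex (ModuleCat.{u} R) :=
      ModuleCat.shortComplexOfCompEqZero _ _ hex.linearMap_comp_eq_zero
    have hS : S.ShortExact := ModuleCat.shortComplex_shortExact S hex hΘ hπ
    have hproj : ∀ l : ℕ, CategoryTheory.Projective (ModuleCat.of R (Fin l → R)) := fun l =>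
      (IsProjective.iff_projective (Fin l → R)).mp inferInstance
    have h1 : CategoryTheory.HasProjectiveDimensionLT S.X₁ 1 :=
      CategoryTheory.projective_iff_hasProjectiveDimensionLT_one.mp (hproj n)
    have h2 : CategoryTheory.HasProjectiveDimensionLT S.X₂ 1 :=
      CategoryTheory.projective_iff_hasProjectiveDimensionLT_one.mp (hproj m)
    exact hS.hasProjectiveDimensionLT_X₃ 1 h1
      (CategoryTheory.hasProjectiveDimensionLT_of_ge _ 1 2 (by norm_num))
  · refine (CategoryTheory.projectiveDimension_ge_iff _ 1).mpr fun h => ?_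
    rw [← CategoryTheory.projective_iff_hasProjectiveDimensionLT_one,
      ← IsProjective.iff_projective] at h
    -- If the cokernel were projective, `Θ` would have a retraction `ρ`. A column of `Θ` has entries
    -- in `I`, so `ρ` would send it into `I ^ n`; but it goes to a basis vector.
    obtain ⟨σ, hσ⟩ := Module.projective_lifting_property π LinearMap.id hπ
    have h1 : ∀ v, v - σ (π v) ∈ LinearMap.range Θ.mulVecLin := fun v => by
      refine (hex _).mp ?_
      have := LinearMap.congr_fun hσ (π v)
      simp only [LinearMap.comp_apply, LinearMap.id_apply] at this
      rw [map_sub, this, sub_self]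
    let e := LinearEquiv.ofInjective Θ.mulVecLin hΘ
    let ρ : (Fin m → R) →ₗ[R] (Fin n → R) :=
      e.symm.toLinearMap ∘ₗ (LinearMap.id - σ ∘ₗ π).codRestrict _ h1
    have h2 : ∀ u, ρ (Θ.mulVecLin u) = u := fun u => by
      change e.symm _ = u
      rw [LinearEquiv.symm_apply_eq]
      apply Subtype.ext
      change Θ.mulVecLin u - σ (π (Θ.mulVecLin u)) = Θ.mulVecLin u
      rw [hex.apply_apply_eq_zero, map_zero, sub_zero]
    have h3 : ∀ v : Fin m → R, (∀ i, v i ∈ I) → ∀ j, ρ v j ∈ I := fun v hv j => by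
      rw [pi_eq_sum_univ v, map_sum, Finset.sum_apply]
      refine Ideal.sum_mem _ fun i _ => ?_
      rw [map_smul, Pi.smul_apply, smul_eq_mul]
      exact I.mul_mem_right _ (hv i)
    refine hI ((Ideal.eq_top_iff_one I).mpr ?_)
    have h4 := h3 (Θ.mulVecLin (Pi.single 0 1)) (fun i => by simpa using hΘI i 0) 0
    rwa [h2, Pi.single_eq_same] at h4

/-! ### Exactness and minimal generators for the differentials -/

namespace IsJacobianPresentation

variable {k R : Type u} [Field k] [CommRing R] [Algebra k R] {m n : Type} [Fintype m]
  {x : m → R} {Θ : Matrix m n R}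

theorem surjective (H : IsJacobianPresentation k x Θ) : Function.Surjective
    (Fintype.linearCombination R fun i => KaehlerDifferential.D k R (x i)) := by
  set π := Fintype.linearCombination R fun i => KaehlerDifferential.D k R (x i)
  rw [← LinearMap.range_eq_top, eq_top_iff, ← KaehlerDifferential.span_range_derivation,
    Submodule.span_le]
  rintro _ ⟨r, rfl⟩
  have h : (LinearMap.range π).mkQ.compDer (KaehlerDifferential.D k R) = 0 :=
    H.derivation_ext fun i => by
      classical
      refine (Submodule.Quotient.mk_eq_zero _).mpr ⟨Pi.single i 1, ?_⟩
      simp [π, Fintype.linearCombination_apply, Pi.single_apply]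
  exact (Submodule.Quotient.mk_eq_zero _).mp (Derivation.congr_fun h r)

theorem exact [Fintype n] (H : IsJacobianPresentation k x Θ) : Function.Exact Θ.mulVecLin
    (Fintype.linearCombination R fun i => KaehlerDifferential.D k R (x i)) := by
  classical
  intro v
  constructor
  · intro hv
    let q := (LinearMap.range Θ.mulVecLin).mkQ
    have hq : ∀ c : m → R, ∑ i, c i • q (Pi.single i 1) = q c := fun c => by
      simp_rw [← map_smul, ← map_sum]
      congr 1
      ext i
      simp [Pi.single_apply]
    -- The derivation `x i ↦ e i` into the cokernel of `Θ` factors through `Ω`, so a relation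
    -- between the differentials vanishes in the cokernel.
    obtain ⟨D, hD⟩ := H.exists_derivation ((m → R) ⧸ LinearMap.range Θ.mulVecLin)
      (fun i => q (Pi.single i 1)) (fun j => by
        rw [hq fun i => Θ i j]
        refine (Submodule.Quotient.mk_eq_zero _).mpr ⟨Pi.single j 1, ?_⟩
        ext i
        simp)
    have h1 := congrArg D.liftKaehlerDifferential hv
    rw [Fintype.linearCombination_apply, map_zero, map_sum] at h1
    simp only [map_smul, Derivation.liftKaehlerDifferential_comp_D, hD] at h1
    rw [hq] at h1
    exact (Submodule.Quotient.mk_eq_zero _).mp h1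
  · rintro ⟨w, rfl⟩
    rw [Fintype.linearCombination_apply]
    simp only [Matrix.mulVecLin_apply, Matrix.mulVec, dotProduct, Finset.sum_smul]
    rw [Finset.sum_comm]
    refine Finset.sum_eq_zero fun j _ => ?_
    have := congrArg (w j • ·) (H.sum_smul_D j)
    simpa [Finset.smul_sum, smul_smul, mul_comm] using this

theorem finite (H : IsJacobianPresentation k x Θ) : Module.Finite R Ω[R⁄k] :=
  Module.Finite.of_surjective _ H.surjective

theorem minGens_eq (H : IsJacobianPresentation k x Θ) {I : Ideal R} (hI : I ≠ ⊤)
    (hΘI : ∀ i j, Θ i j ∈ I) : minGens R Ω[R⁄k] = Fintype.card m := by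
  classical
  have := H.finite
  have hR : Nontrivial R := by
    by_contra h
    rw [not_nontrivial_iff_subsingleton] at h
    exact hI (Subsingleton.elim _ _)
  apply le_antisymm
  · have h1 := Submodule.spanFinrank_map_le_of_fg (p := ⊤)
      (Fintype.linearCombination R fun i => KaehlerDifferential.D k R (x i)) Module.Finite.fg_top
    rwa [Submodule.map_top, LinearMap.range_eq_top.mpr H.surjective,
      ← Module.finrank_eq_spanFinrank_of_free (M := m → R), Module.finrank_pi] at h1
  · obtain ⟨M, hM, hIM⟩ := Ideal.exists_le_maximal I hI
    let : Field (R ⧸ M) := Ideal.Quotient.field M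
    -- `Θ` vanishes modulo `M`, so the `x i` may be sent to the standard basis; this maps `Ω` onto
    -- `(R ⧸ M) ^ m` and bounds its generators from below.
    obtain ⟨D, hD⟩ := H.exists_derivation (m → R ⧸ M) (fun i => Pi.single i 1) (fun j => by
      refine Finset.sum_eq_zero fun i _ => ?_
      ext l
      rw [Pi.smul_apply, Algebra.smul_def, Ideal.Quotient.algebraMap_eq,
        Ideal.Quotient.eq_zero_iff_mem.mpr (hIM (hΘI i j)), zero_mul, Pi.zero_apply])
    let ψ : Ω[R⁄k] →ₛₗ[Ideal.Quotient.mk M] (m → R ⧸ M) :=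
      { toFun := D.liftKaehlerDifferential
        map_add' := map_add _
        map_smul' := fun r ω => by
          rw [map_smul]
          ext l
          rw [Pi.smul_apply, Algebra.smul_def]
          rfl }
    have hsurj : LinearMap.range ψ = ⊤ := by
      rw [eq_top_iff, ← (Pi.basisFun (R ⧸ M) m).span_eq, Submodule.span_le]
      rintro _ ⟨i, rfl⟩
      refine ⟨KaehlerDifferential.D k R (x i), ?_⟩
      change D.liftKaehlerDifferential _ = _
      rw [Derivation.liftKaehlerDifferential_comp_D, hD, Pi.basisFun_apply]
    have h1 := Submodule.spanFinrank_map_le_of_fg ψ (p := ⊤) Module.Finite.fg_top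
    rwa [Submodule.map_top, hsurj, ← Module.finrank_eq_spanFinrank_of_free, Module.finrank_pi]
      at h1

end IsJacobianPresentation

/-! ### Height-one primes and full rank there -/

/-- The localization is a Noetherian integrally closed local domain of dimension at most one, so
Dedekind, and its maximal ideal is principal; clearing denominators gives the generator. -/
theorem exists_locally_principal_generator {R : Type*} [CommRing R] [IsDomain R]
    [IsNoetherianRing R] (P : Ideal R) [P.IsPrime]
    [IsIntegrallyClosed (Localization.AtPrime P)]
    (hP : ∀ Q : Ideal R, Q.IsPrime → Q < P → Q = ⊥) :
    ∃ π ∈ P, ∀ p ∈ P, ∃ s ∉ P, ∃ a, s * p = a * π := by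
  let A := Localization.AtPrime P
  have : IsNoetherianRing A := IsLocalization.isNoetherianRing P.primeCompl A inferInstance
  have : Ring.DimensionLEOne A := by
    refine ⟨fun {q} hq hqp => ?_⟩
    have h1 : q.under R = P := by
      by_contra h
      have h2 : q.under R ≤ P :=
        (Ideal.comap_mono (IsLocalRing.le_maximalIdeal hqp.ne_top)).trans
          (IsLocalization.AtPrime.under_maximalIdeal A P).le
      have h3 := hP _ inferInstance (lt_of_le_of_ne h2 h)
      apply hq
      rw [← IsLocalization.map_under P.primeCompl A q, h3, Ideal.map_bot]
    rw [← IsLocalization.map_under P.primeCompl A q, h1,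
      Localization.AtPrime.map_eq_maximalIdeal]
    infer_instance
  have : IsDedekindDomain A := { }
  obtain ⟨y, hy⟩ := (maximalIdeal_isPrincipal_of_isDedekindDomain A).principal
  obtain ⟨π, s, rfl⟩ := IsLocalization.exists_mk'_eq P.primeCompl y
  refine ⟨π, ?_, fun p hp => ?_⟩
  · have h1 : IsLocalization.mk' A π s ∈ IsLocalRing.maximalIdeal A := by
      rw [hy]
      exact Submodule.mem_span_singleton_self _
    exact (IsLocalization.AtPrime.mk'_mem_maximal_iff A P π s).mp h1
  · have h1 : algebraMap R A p ∈ IsLocalRing.maximalIdeal A :=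
      (IsLocalization.AtPrime.to_map_mem_maximal_iff A P p).mpr hp
    rw [hy] at h1
    obtain ⟨z, hz⟩ := Submodule.mem_span_singleton.mp h1
    obtain ⟨a, t, rfl⟩ := IsLocalization.exists_mk'_eq P.primeCompl z
    rw [smul_eq_mul, ← IsLocalization.mk'_mul, IsLocalization.mk'_eq_iff_eq_mul, ← map_mul] at hz
    have h2 := IsLocalization.injective A P.primeCompl_le_nonZeroDivisors hz
    refine ⟨_, (t * s).2, a, ?_⟩
    rw [h2, mul_comm]

theorem eq_bot_of_lt_of_height_le_one {R : Type*} [CommRing R] [IsDomain R] {P : Ideal R}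
    [P.IsPrime] (hP : P.height ≤ 1) {Q : Ideal R} (hQ : Q.IsPrime) (hQP : Q < P) : Q = ⊥ := by
  have h1 := (Ideal.height_le_iff (n := 1)).mp hP Q hQ hQP
  rwa [Nat.cast_one, Order.lt_one_iff, Ideal.height_eq_zero_iff_eq_bot] at h1

theorem trdeg_quotient_le {k R : Type u} [Field k] [CommRing R] [Algebra k R] [IsDomain R] {d : ℕ} (htr : Algebra.trdeg k R ≤ (d + 1 : ℕ))
    {P : Ideal R} [P.IsPrime] (hP : P ≠ ⊥) : Algebra.trdeg k (R ⧸ P) ≤ d :=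
  trdeg_le_of_surjective_of_not_injective (Ideal.Quotient.mkₐ k P)
    (Ideal.Quotient.mkₐ_surjective k P) (fun h => hP (by
      rw [← Ideal.Quotient.mkₐ_ker k P]
      exact (RingHom.injective_iff_ker_eq_bot _).mp h)) htr

namespace IsJacobianPresentation

variable {k R : Type u} [Field k] [CharZero k] [CommRing R] [Algebra k R]

/-- From `s * p = a * π`, a derivation into `Frac(R/P)` that kills `π` satisfies `s • D p = 0`,
hence kills `P`. The local generator thus costs one value beyond the `d` needed for `R ⧸ P`. -/
theorem exists_mul_eq_smul_one_of_locally_principal {d c : ℕ} {x : Fin (d + 1 + c) → R}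
    {Θ : Matrix (Fin (d + 1 + c)) (Fin c) R} (H : IsJacobianPresentation k x Θ) (P : Ideal R)
    [P.IsPrime] (htr : Algebra.trdeg k (R ⧸ P) ≤ d)
    (hP : ∃ π ∈ P, ∀ p ∈ P, ∃ s ∉ P, ∃ a, s * p = a * π) :
    ∃ (C : Matrix (Fin c) (Fin (d + 1 + c)) R) (δ : R), δ ∉ P ∧
      C * Θ = δ • (1 : Matrix (Fin c) (Fin c) R) := by
  obtain ⟨b, hb⟩ := exists_fin_forall_derivation_eq_zero_of_prime P htr
  obtain ⟨π, hπ, hloc⟩ := hP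
  refine H.exists_mul_eq_smul_one P (Fin.snoc b π : Fin (d + 1) → R) fun D hD => hb D ?_ ?_
  · intro p hp
    obtain ⟨s, hs, a, hsa⟩ := hloc p hp
    have hDπ : D π = 0 := by simpa using hD (Fin.last d)
    have h0 : ∀ q ∈ P, ∀ y : FractionRing (R ⧸ P), q • y = 0 := fun q hq y => by
      rw [Algebra.smul_def, IsScalarTower.algebraMap_apply R (R ⧸ P), Ideal.Quotient.algebraMap_eq,
        Ideal.Quotient.eq_zero_iff_mem.mpr hq, map_zero, zero_mul]
    have h1 := congrArg D hsa
    rw [D.leibniz, D.leibniz, hDπ, h0 p hp, h0 π hπ, smul_zero, add_zero, add_zero,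
      Algebra.smul_def] at h1
    refine (mul_eq_zero.mp h1).resolve_left fun h2 => hs ?_
    rw [IsScalarTower.algebraMap_apply R (R ⧸ P), IsFractionRing.to_map_eq_zero_iff] at h2
    exact Ideal.Quotient.eq_zero_iff_mem.mp h2
  · intro i
    simpa using hD i.castSucc

theorem exists_mul_eq_smul_one_of_trdeg_le [IsDomain R] {d c : ℕ} {x : Fin (d + c) → R}
    {Θ : Matrix (Fin (d + c)) (Fin c) R} (H : IsJacobianPresentation k x Θ)
    (htr : Algebra.trdeg k R ≤ d) :
    ∃ (C : Matrix (Fin c) (Fin (d + c)) R) (δ : R), δ ≠ 0 ∧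
      C * Θ = δ • (1 : Matrix (Fin c) (Fin c) R) := by
  have htr' : Algebra.trdeg k (R ⧸ (⊥ : Ideal R)) ≤ d :=
    (trdeg_le_of_surjective (Ideal.Quotient.mkₐ k ⊥)
      (Ideal.Quotient.mkₐ_surjective k ⊥)).trans htr
  obtain ⟨b, hb⟩ := exists_fin_forall_derivation_eq_zero_of_prime (⊥ : Ideal R) htr'
  obtain ⟨C, δ, hδ, hC⟩ := H.exists_mul_eq_smul_one ⊥ b fun D hD => hb D (fun p hp => by
    rw [(Submodule.mem_bot R).mp hp, map_zero]) hD
  exact ⟨C, δ, hδ, hC⟩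

variable [IsDomain R] {d c : ℕ} {x : Fin (d + 1 + c) → R}
  {Θ : Matrix (Fin (d + 1 + c)) (Fin c) R}

theorem injective (H : IsJacobianPresentation k x Θ) (htr : Algebra.trdeg k R ≤ (d + 1 : ℕ)) :
    Function.Injective Θ.mulVecLin := by
  obtain ⟨C, δ, hδ, hC⟩ := H.exists_mul_eq_smul_one_of_trdeg_le htr
  rw [injective_iff_map_eq_zero]
  intro v hv
  have h1 := congrArg C.mulVec hv
  rw [Matrix.mulVecLin_apply, Matrix.mulVec_mulVec, hC, Matrix.smul_mulVec, Matrix.one_mulVec,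
    Matrix.mulVec_zero] at h1
  exact (smul_eq_zero.mp h1).resolve_left hδ

theorem hasRank (H : IsJacobianPresentation k x Θ) (htr : Algebra.trdeg k R ≤ (d + 1 : ℕ)) :
    HasRank R Ω[R⁄k] (d + 1) := by
  obtain ⟨C, δ, hδ, hC⟩ := H.exists_mul_eq_smul_one_of_trdeg_le htr
  have := H.finite
  have h1 := finrank_tensor_eq_of_exact (L := FractionRing R) H.surjective H.exact hC
    (IsFractionRing.to_map_eq_zero_iff.not.mpr hδ)
  exact ⟨LinearEquiv.ofFinrankEq _ _ (by rw [h1, Module.finrank_fin_fun])⟩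

theorem isTorsionFree [IsNoetherianRing R] [IsIntegrallyClosed R] (H : IsJacobianPresentation k x Θ)
    (htr : Algebra.trdeg k R ≤ (d + 1 : ℕ)) : Module.IsTorsionFree R Ω[R⁄k] :=
  isTorsionFree_of_exact H.surjective H.exact fun P _ hP0 hP =>
    H.exists_mul_eq_smul_one_of_locally_principal P (trdeg_quotient_le htr hP0) hP

theorem satisfiesG [IsNoetherianRing R] (H : IsJacobianPresentation k x Θ) (htr : Algebra.trdeg k R ≤ (d + 1 : ℕ))
    (hR : IsNormalRing R) : SatisfiesG R Ω[R⁄k] (d + 1) 2 := by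
  intro p hp h1 h2
  have := H.finite
  rw [IsLocalization.AtPrime.ringKrullDim_eq_height p] at h1 h2 ⊢
  have h3 : p.height = 1 := by
    have h4 : p.height + 1 ≤ 1 + 1 := by
      rw [one_add_one_eq_two]
      exact WithBot.coe_le_coe.mp h2
    exact le_antisymm ((ENat.add_le_add_iff_right ENat.one_ne_top).mp h4) (by exact_mod_cast h1)
  have hp0 : p ≠ ⊥ := by
    rintro rfl
    simp at h3
  have := (hR p).2
  obtain ⟨C, δ, hδ, hC⟩ := H.exists_mul_eq_smul_one_of_locally_principal p
    (trdeg_quotient_le htr hp0) (exists_locally_principal_generator p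
      fun Q hQ hQP => eq_bot_of_lt_of_height_le_one h3.le hQ hQP)
  rw [minGens_localizedModule_eq_finrank, finrank_tensor_eq_of_exact H.surjective H.exact hC, h3]
  · rw [add_comm]
    rfl
  · rwa [Ne, Ideal.algebraMap_residueField_eq_zero]

end IsJacobianPresentation

/-! ### The quadric complete intersection: domain and dimension -/

theorem MvPolynomial.IsHomogeneous.eq_sum_of_degree_one {k σ : Type*} [CommRing k] [Fintype σ]
    {p : MvPolynomial σ k} (hp : p.IsHomogeneous 1) :
    p = ∑ i, coeff 0 (pderiv i p) • X i := by
  classical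
  have h := hp.sum_X_mul_pderiv
  rw [one_smul] at h
  conv_lhs => rw [← h]
  refine Finset.sum_congr rfl fun i _ => ?_
  have h1 : (pderiv i p).IsHomogeneous 0 := hp.pderiv
  rw [(totalDegree_eq_zero_iff_eq_C).mp ((totalDegree_zero_iff_isHomogeneous σ).mpr h1),
    coeff_C, if_pos rfl, mul_comm, smul_eq_C_mul]

section

variable {k : Type*} [Field k] {n : ℕ} {f g : MvPolynomial (Fin n) k}

theorem span_pair_le_ker_constantCoeff (hf : f.IsHomogeneous 2) (hg : g.IsHomogeneous 2) :
    Ideal.span {f, g} ≤ RingHom.ker (constantCoeff (σ := Fin n) (R := k)) := by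
  rw [Ideal.span_le]
  have h : ∀ p : MvPolynomial (Fin n) k, p.IsHomogeneous 2 → constantCoeff p = 0 := fun p hp =>
    hp.coeff_eq_zero (by simp)
  rintro p (rfl | rfl)
  · exact h _ hf
  · exact h _ hg

theorem irrelevantIdeal_ne_top (hf : f.IsHomogeneous 2) (hg : g.IsHomogeneous 2) :
    irrelevantIdeal f g ≠ ⊤ := by
  have h : irrelevantIdeal f g ≤
      RingHom.ker (Ideal.Quotient.lift _ _ (span_pair_le_ker_constantCoeff hf hg)) := by
    rw [irrelevantIdeal, Ideal.span_le]
    rintro _ ⟨i, rfl⟩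
    exact constantCoeff_X k i
  exact fun h' => RingHom.ker_ne_top _ (top_le_iff.mp (h' ▸ h))

/-- A complete intersection of quadrics whose local ring at the origin is a domain is a domain. -/
theorem isPrime_span_pair (hf : f.IsHomogeneous 2) (hg : g.IsHomogeneous 2)
    (hnormal : IsNormalRing (CIRing f g)) : (Ideal.span {f, g}).IsPrime := by
  have hle := span_pair_le_ker_constantCoeff hf hg
  let : GradedAlgebra (homogeneousSubmodule (Fin n) k) := gradedAlgebra
  have hI : (Ideal.span {f, g}).IsHomogeneous (homogeneousSubmodule (Fin n) k) := by
    apply Ideal.homogeneous_span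
    rintro p (rfl | rfl)
    · exact ⟨2, hf⟩
    · exact ⟨2, hg⟩
  let ε : CIRing f g →+* k := Ideal.Quotient.lift _ _ hle
  let P := RingHom.ker ε
  have hP : P.IsPrime := RingHom.ker_isPrime ε
  have hdom := (hnormal P).1
  refine hI.isPrime_of_homogeneous_mem_or_mem
    (fun h => RingHom.ker_ne_top _ (top_le_iff.mp (h ▸ hle))) ?_
  have key : ∀ x : MvPolynomial (Fin n) k,
      SetLike.IsHomogeneousElem (homogeneousSubmodule (Fin n) k) x →
      algebraMap (CIRing f g) (Localization.AtPrime P) (Ideal.Quotient.mk _ x) = 0 →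
      x ∈ Ideal.span {f, g} := by
    rintro x ⟨m, hx⟩ h0
    obtain ⟨⟨s, hs⟩, hsx⟩ := (IsLocalization.map_eq_zero_iff P.primeCompl _ _).mp h0
    obtain ⟨t, rfl⟩ := Ideal.Quotient.mk_surjective s
    have ht : constantCoeff t ≠ 0 := hs
    have htx : t * x ∈ Ideal.span {f, g} := by
      rw [← Ideal.Quotient.eq_zero_iff_mem, map_mul]
      exact hsx
    -- The degree `m` part of `t * x` is `C (constantCoeff t) * x`, with a unit coefficient, so
    -- homogeneous elements that die at the origin already lie in the ideal.
    have h1 := hI (0 + m) htx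
    rw [DirectSum.coe_decompose_mul_add_of_right_mem _ hx] at h1
    have h2 : ((DirectSum.decompose (homogeneousSubmodule (Fin n) k) t 0 :
        homogeneousSubmodule (Fin n) k 0) : MvPolynomial (Fin n) k) = C (constantCoeff t) :=
      (decomposition.decompose'_apply t 0).trans (homogeneousComponent_zero t)
    rw [h2] at h1
    have h3 := Ideal.mul_mem_left _ (C (constantCoeff t)⁻¹) h1
    rwa [← mul_assoc, ← map_mul, inv_mul_cancel₀ ht, map_one, one_mul] at h3
  intro x y hx hy hxy
  have h0 : algebraMap (CIRing f g) (Localization.AtPrime P) (Ideal.Quotient.mk _ x) *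
      algebraMap (CIRing f g) (Localization.AtPrime P) (Ideal.Quotient.mk _ y) = 0 := by
    rw [← map_mul, ← map_mul, Ideal.Quotient.eq_zero_iff_mem.mpr hxy, map_zero]
  exact (mul_eq_zero.mp h0).imp (key x hx) (key y hy)

end

theorem dvd_of_dvd_mul_of_isRegular {S : Type*} [CommRing S] {f g h : S}
    (hreg : RingTheory.Sequence.IsRegular S [f, g]) (hh : f ∣ g * h) : f ∣ h := by
  have h1 := ((RingTheory.Sequence.isWeaklyRegular_cons_iff S f [g]).mp hreg.1).2
  rw [RingTheory.Sequence.isWeaklyRegular_singleton_iff, isSMulRegular_iff_right_eq_zero_of_smul]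
    at h1
  have h2 : ∀ z : S, (Submodule.Quotient.mk z : QuotSMulTop f S) = 0 ↔ f ∣ z := fun z => by
    rw [Submodule.Quotient.mk_eq_zero, Submodule.mem_smul_pointwise_iff_exists]
    simp [dvd_def, eq_comm]
  exact (h2 h).mp (h1 _ ((h2 (g * h)).mpr hh))

/-- The prime `(f, g)` contains a prime element `q` and strictly contains `(q)`, so the
transcendence degree drops twice. -/
theorem trdeg_CIRing_le {k : Type u} [Field k] {n : ℕ} {f g : MvPolynomial (Fin (n + 2)) k}
    (hreg : RingTheory.Sequence.IsRegular (MvPolynomial (Fin (n + 2)) k) [f, g])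
    (hprime : (Ideal.span {f, g}).IsPrime) : Algebra.trdeg k (CIRing f g) ≤ n := by
  have hf : f ≠ 0 := by
    rintro rfl
    have h1 := ((RingTheory.Sequence.isWeaklyRegular_cons_iff _ _ _).mp hreg.1).1
    rw [isSMulRegular_iff_right_eq_zero_of_smul] at h1
    exact one_ne_zero (h1 1 (zero_smul _ _))
  have hne : Ideal.span {f, g} ≠ ⊥ := fun h => hf
    ((Submodule.mem_bot _).mp (h ▸ Ideal.subset_span (Set.mem_insert f {g})))
  obtain ⟨q, hqI, hq⟩ := hprime.exists_mem_prime_of_ne_bot hne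
  have hqle : Ideal.span {q} ≤ Ideal.span {f, g} := by
    rwa [Ideal.span_le, Set.singleton_subset_iff]
  -- If `f = q a` and `g = q b`, then `g a = f b`, so regularity gives `a = f c`; then `f = q f c`
  -- makes `q` a unit.
  have hlt : ¬ Ideal.span {f, g} ≤ Ideal.span {q} := fun h => by
    obtain ⟨a, ha⟩ := Ideal.mem_span_singleton.mp (h (Ideal.subset_span (Set.mem_insert f {g})))
    obtain ⟨b, hb⟩ := Ideal.mem_span_singleton.mp
      (h (Ideal.subset_span (Set.mem_insert_of_mem f rfl)))
    obtain ⟨c, hc⟩ := dvd_of_dvd_mul_of_isRegular hreg (h := a) ⟨b, by rw [ha, hb]; ring⟩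
    refine hq.not_isUnit (IsUnit.of_mul_eq_one c ?_)
    apply mul_left_cancel₀ hf
    linear_combination -ha - q * hc
  have : (Ideal.span {q}).IsPrime := (Ideal.span_singleton_prime hq.ne_zero).mpr hq
  have h0 : Algebra.trdeg k (MvPolynomial (Fin (n + 2)) k) ≤ (n + 1 + 1 : ℕ) := by
    rw [MvPolynomial.trdeg_of_isDomain]
    simp [add_assoc, one_add_one_eq_two]
  have h1 := trdeg_quotient_le h0 (P := Ideal.span {q}) (by
    rw [Ne, Ideal.span_singleton_eq_bot]
    exact hq.ne_zero)
  refine trdeg_le_of_surjective_of_not_injective (Ideal.Quotient.factorₐ k hqle)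
    (Ideal.Quotient.factor_surjective hqle) (fun hinj => hlt fun z hz => ?_) h1
  rw [← Ideal.Quotient.eq_zero_iff_mem]
  apply hinj
  rw [map_zero]
  exact Ideal.Quotient.eq_zero_iff_mem.mpr hz

theorem isIntegrallyClosed_of_isNormalRing {R : Type*} [CommRing R] [IsDomain R]
    (hR : IsNormalRing R) : IsIntegrallyClosed R :=
  IsIntegrallyClosed.of_localization_maximal fun p _ _ => (hR p).2

/-! ### The ideal of entries -/

section

variable {k : Type u} [Field k] {n : ℕ} {f g : MvPolynomial (Fin n) k}

theorem isHomogeneous_pderiv_pair (hf : f.IsHomogeneous 2) (hg : g.IsHomogeneous 2) (i : Fin n)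
    (j : Fin 2) : (pderiv i (![f, g] j)).IsHomogeneous 1 := by
  fin_cases j
  · exact hf.pderiv
  · exact hg.pderiv

theorem jacobianTranspose_mem_irrelevantIdeal (hf : f.IsHomogeneous 2) (hg : g.IsHomogeneous 2)
    (i : Fin n) (j : Fin 2) : jacobianTranspose f g i j ∈ irrelevantIdeal f g := by
  change Ideal.Quotient.mk _ (pderiv i (![f, g] j)) ∈ _
  rw [(isHomogeneous_pderiv_pair hf hg i j).eq_sum_of_degree_one, map_sum]
  refine Ideal.sum_mem _ fun l _ => ?_
  rw [smul_eq_C_mul, map_mul]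
  exact Ideal.mul_mem_left _ _ (Ideal.subset_span ⟨l, rfl⟩)

/-- If the linear forms in the Jacobian matrix do not span all linear forms, then `V(f, g)`
contains a line along which the Jacobian matrix vanishes. -/
theorem exists_line_of_entriesIdeal_ne [CharZero k] (hf : f.IsHomogeneous 2)
    (hg : g.IsHomogeneous 2) (hne : entriesIdeal (jacobianTranspose f g) ≠ irrelevantIdeal f g) :
    ∃ φ : CIRing f g →ₐ[k] Polynomial k, (∀ i j, φ (jacobianTranspose f g i j) = 0) ∧
      ∃ (i : Fin n) (a : k), a ≠ 0 ∧
        φ (Ideal.Quotient.mk _ (X i)) = Polynomial.C a * Polynomial.X := by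
  classical
  let row : Fin n × Fin 2 → (Fin n → k) := fun q l => coeff 0 (pderiv l (pderiv q.1 (![f, g] q.2)))
  have hrow : ∀ q : Fin n × Fin 2, pderiv q.1 (![f, g] q.2) = ∑ l, row q l • X l := fun q =>
    (isHomogeneous_pderiv_pair hf hg q.1 q.2).eq_sum_of_degree_one
  have hlt : Submodule.span k (Set.range row) < ⊤ := by
    rw [lt_top_iff_ne_top]
    intro htop
    apply hne
    apply le_antisymm
    · rw [entriesIdeal, Ideal.span_le]
      rintro _ ⟨i, j, rfl⟩
      exact jacobianTranspose_mem_irrelevantIdeal hf hg i j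
    · let L : (Fin n → k) →ₗ[k] CIRing f g :=
        Fintype.linearCombination k fun i => Ideal.Quotient.mk (Ideal.span {f, g}) (X i)
      have h1 : Submodule.span k (Set.range row) ≤
          ((entriesIdeal (jacobianTranspose f g)).restrictScalars k).comap L := by
        rw [Submodule.span_le]
        rintro _ ⟨q, rfl⟩
        have h2 : L (row q) = jacobianTranspose f g q.1 q.2 := by
          refine Eq.trans ?_ (congrArg (Ideal.Quotient.mk (Ideal.span {f, g})) (hrow q)).symm
          rw [Fintype.linearCombination_apply, map_sum]
          rfl
        change L (row q) ∈ entriesIdeal _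
        rw [h2]
        exact Ideal.subset_span ⟨q.1, q.2, rfl⟩
      rw [irrelevantIdeal, Ideal.span_le]
      rintro _ ⟨i, rfl⟩
      have h3 : L (Pi.single i 1) ∈ entriesIdeal (jacobianTranspose f g) :=
        h1 (htop ▸ Submodule.mem_top)
      rwa [Fintype.linearCombination_apply_single, one_smul] at h3
  -- A nonzero functional killing the coefficient vectors is a common zero `a` of the linear forms;
  -- `Φ` restricts polynomials to the line `T ↦ a T`.
  obtain ⟨F, hF, hker⟩ := Submodule.exists_le_ker_of_lt_top _ hlt
  let a : Fin n → k := fun i => F (Pi.single i 1)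
  let Φ : MvPolynomial (Fin n) k →ₐ[k] Polynomial k :=
    aeval fun i => Polynomial.C (a i) * Polynomial.X
  have hΦ : ∀ i j, Φ (pderiv i (![f, g] j)) = 0 := by
    intro i j
    have h1 : F (row (i, j)) = 0 := hker (Submodule.subset_span ⟨(i, j), rfl⟩)
    rw [F.pi_apply_eq_sum_univ] at h1
    rw [hrow (i, j), map_sum]
    have h2 : ∀ l, Φ (row (i, j) l • X l) = Polynomial.C (row (i, j) l * a l) * Polynomial.X := by
      intro l
      rw [map_smul, aeval_X, Polynomial.smul_eq_C_mul, ← mul_assoc, ← map_mul]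
    simp_rw [h2]
    rw [← Finset.sum_mul, ← map_sum]
    have h3 : ∑ l, row (i, j) l * a l = 0 := by
      rw [← h1]
      refine Finset.sum_congr rfl fun l _ => ?_
      change row (i, j) l * F (Pi.single l 1) = row (i, j) l * F _
      congr 2
      ext m
      simp [Pi.single_apply, eq_comm]
    rw [h3, map_zero, zero_mul]
  have hΦj : ∀ j, Φ (![f, g] j) = 0 := by
    intro j
    have h1 : (![f, g] j).IsHomogeneous 2 := by
      fin_cases j
      · exact hf
      · exact hg
    -- Euler's formula: twice the quadric is a combination of its partials, which vanish on the
    -- line.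
    have h2 := congrArg Φ h1.sum_X_mul_pderiv
    rw [map_sum] at h2
    simp only [map_mul, hΦ, mul_zero, Finset.sum_const_zero, map_nsmul] at h2
    exact (smul_eq_zero.mp h2.symm).resolve_left two_ne_zero
  refine ⟨Ideal.Quotient.liftₐ (Ideal.span {f, g}) Φ ?_, fun i j => ?_, ?_⟩
  · intro p hp
    have h1 : Ideal.span {f, g} ≤ RingHom.ker Φ := by
      rw [Ideal.span_le]
      rintro p (rfl | rfl)
      · exact hΦj 0
      · exact hΦj 1
    exact h1 hp
  · exact hΦ i j
  · obtain ⟨i, hi⟩ : ∃ i, a i ≠ 0 := by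
      by_contra! h
      apply hF
      refine LinearMap.pi_ext' fun i => LinearMap.ext_ring ?_
      exact h i
    exact ⟨i, a i, hi, aeval_X _ i⟩

end

/-- The kernel of a map to `k[T]` hitting a nonzero multiple of `T` has height at most one
if the ring has transcendence degree at most two. -/
theorem eq_bot_of_lt_ker_of_trdeg_le {k R : Type u} [Field k] [CommRing R] [IsDomain R]
    [Algebra k R] (htr : Algebra.trdeg k R ≤ (1 + 1 : ℕ)) (φ : R →ₐ[k] Polynomial k) {r : R} {a : k}
    (ha : a ≠ 0) (hr : φ r = Polynomial.C a * Polynomial.X) {Q : Ideal R} (hQ : Q.IsPrime)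
    (hQP : Q < RingHom.ker φ) : Q = ⊥ := by
  by_contra hQ0
  have h1 := trdeg_quotient_le htr hQ0
  have : (RingHom.ker φ).IsPrime := RingHom.ker_isPrime φ.toRingHom
  have h2 : Algebra.trdeg k (R ⧸ RingHom.ker φ) ≤ (0 : ℕ) := by
    refine trdeg_le_of_surjective_of_not_injective (Ideal.Quotient.factorₐ k hQP.le)
      (Ideal.Quotient.factor_surjective hQP.le) (fun hinj => hQP.not_ge fun z hz => ?_) h1
    rw [← Ideal.Quotient.eq_zero_iff_mem]
    apply hinj
    rw [map_zero]
    exact Ideal.Quotient.eq_zero_iff_mem.mpr hz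
  -- A nonzero prime strictly below the kernel would make `R ⧸ ker φ` algebraic over `k`, yet its
  -- image contains the transcendental `a T`.
  rw [Nat.cast_zero, nonpos_iff_eq_zero, trdeg_eq_zero_iff] at h2
  have h3 := (h2.isAlgebraic (Ideal.Quotient.mk _ r)).algHom (Ideal.kerLiftAlg φ)
  have h4 : IsAlgebraic k (Polynomial.C a * Polynomial.X : Polynomial k) := by
    rw [← hr]
    exact h3
  refine Polynomial.transcendental_X k
    (IsAlgebraic.of_aeval (Polynomial.C a * Polynomial.X) ?_ ?_ (by simpa using h4))
  · rw [Polynomial.natDegree_C_mul_X _ ha]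
    exact one_ne_zero
  · simpa using ha

theorem entriesIdeal_jacobianTranspose_eq {k : Type u} [Field k] [CharZero k]
    {f g : MvPolynomial (Fin 4) k} (hf : f.IsHomogeneous 2) (hg : g.IsHomogeneous 2)
    [IsDomain (CIRing f g)] (htr : Algebra.trdeg k (CIRing f g) ≤ (1 + 1 : ℕ))
    (hnormal : IsNormalRing (CIRing f g)) :
    entriesIdeal (jacobianTranspose f g) = irrelevantIdeal f g := by
  by_contra hne
  obtain ⟨φ, hφ, i, a, ha, hi⟩ := exists_line_of_entriesIdeal_ne hf hg hne
  have H := isJacobianPresentation_jacobianTranspose f g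
  have hP : (RingHom.ker φ).IsPrime := RingHom.ker_isPrime φ.toRingHom
  have hP0 : RingHom.ker φ ≠ ⊥ := by
    intro h0
    have h1 : ∀ i j, jacobianTranspose f g i j = 0 := fun i j => by
      have h : jacobianTranspose f g i j ∈ RingHom.ker φ := hφ i j
      rwa [h0, Submodule.mem_bot] at h
    have h2 := H.injective (d := 1) (c := 2) htr (a₁ := Pi.single 0 1) (a₂ := 0) (by
      ext l
      simp [h1])
    simpa using congrFun h2 0
  have := (hnormal (RingHom.ker φ)).2
  obtain ⟨C, δ, hδ, hC⟩ := H.exists_mul_eq_smul_one_of_locally_principal (d := 1) (c := 2)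
    (RingHom.ker φ) (trdeg_quotient_le htr hP0)
    (exists_locally_principal_generator _ fun Q hQ hQP =>
      eq_bot_of_lt_ker_of_trdeg_le htr φ ha hi hQ hQP)
  -- `δ` is a combination of entries of the matrix, all of which lie in the kernel.
  apply hδ
  have h1 := congrFun (congrFun hC 0) 0
  rw [Matrix.mul_apply, Matrix.smul_apply, Matrix.one_apply_eq, smul_eq_mul, mul_one] at h1
  rw [← h1]
  exact Ideal.sum_mem _ fun l _ => Ideal.mul_mem_left _ _ (hφ l 0)

/-! ### The main theorem -/

theorem mainTheorem7 {k : Type*} [Field k] [CharZero k]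
    (f g : MvPolynomial (Fin 4) k)
    (hf : f.IsHomogeneous 2) (hg : g.IsHomogeneous 2)
    (hreg : RingTheory.Sequence.IsRegular (MvPolynomial (Fin 4) k) [f, g])
    (hnormal : IsNormalRing (CIRing f g)) :
    LinearlyPresentedOverQuadricCI (d := 2) 2 f g (Ω[CIRing f g⁄k])
      (jacobianTranspose f g) (differentialsMap f g) := by
  have hprime := isPrime_span_pair hf hg hnormal
  have hdom : IsDomain (CIRing f g) := Ideal.Quotient.isDomain _
  have htr : Algebra.trdeg k (CIRing f g) ≤ (1 + 1 : ℕ) := trdeg_CIRing_le (n := 2) hreg hprime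
  have hic := isIntegrallyClosed_of_isNormalRing hnormal
  have H := isJacobianPresentation_jacobianTranspose f g
  have hinj := H.injective (d := 1) (c := 2) htr
  exact
    { two_le_d := le_rfl
      one_le_e := one_le_two
      homogeneous_f := hf
      homogeneous_g := hg
      regular := hreg
      finite := H.finite
      torsionFree := H.isTorsionFree (d := 1) (c := 2) htr
      rank := H.hasRank (d := 1) (c := 2) htr
      projDim := projectiveDimension_eq_one_of_exact hinj H.surjective H.exact
        (irrelevantIdeal_ne_top hf hg) (jacobianTranspose_mem_irrelevantIdeal hf hg)
      minGens_eq := H.minGens_eq (irrelevantIdeal_ne_top hf hg)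
        (jacobianTranspose_mem_irrelevantIdeal hf hg)
      injective := hinj
      exact := H.exact
      surjective := H.surjective
      minimal := jacobianTranspose_mem_irrelevantIdeal hf hg
      linear := ⟨Matrix.of fun i j => pderiv i (![f, g] j), isHomogeneous_pderiv_pair hf hg, rfl⟩
      satisfiesG := H.satisfiesG (d := 1) (c := 2) htr hnormal
      entriesIdeal_eq := entriesIdeal_jacobianTranspose_eq hf hg htr hnormal }
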